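/- Let $k$ be a commutative semiring with unit, let $S$ be a finite semigroup, and let $M$ be a right module over the (not necessarily unital) semigroup algebra $kS$. Call $M$ \emph{irreducible} if $M\cdot kS\neq 0$, the only $kS$-submodules of $M$ are $0$ and $M$, and the only $kS$-module congruences on $M$ are equality and the universal congruence. Call $M$ \emph{faithful} if, for $s,t\in S$, $ms=mt$ for all $m\in M$ implies $s=t$. Put $J(s)=S^1sS^1$; the $\mathscr J$-classes of $S$ are the classes of the relation $J(s)=J(t)$, and a $\mathscr J$-class is \emph{regular} if it contains an element $s$ with $s\in sSs$. A regular $\mathscr J$-class $J$ is the \emph{apex} of $M$ if $\{s\in S\mid Ms=0\}=\{s\in S\mid J\nsubseteq J(s)\}$. The semigroup $S$ is \emph{generalized group mapping} if it has a \emph{distinguished} ideal, that is, a minimal or $0$-minimal ideal $I$ such that $S$ acts faithfully on $I$ both by left and by right multiplication. Suppose that $M$ is irreducible and faithful. Then $M$ has a unique apex $J$, the semigroup $S$ is generalized group mapping, and its distinguished ideal is $J$ or $J\cup\{0\}$ (the latter with $0$ a zero element of $S$); more precisely, every distinguished ideal of $S$ is of this form. If moreover the addition of $M$ is idempotent ($m+m=m$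 for all $m\in M$), then the distinguished ideal is an aperiodic semigroup, i.e. all its maximal subgroups are trivial. -/

import Mathlib

namespace SemigroupRep

section Semigroups

variable {S : Type*} [Semigroup S]

/-- The principal two-sided ideal `J(s) = S¹ s S¹`. -/
def principalIdeal (s : S) : Set S :=
  {x | ∃ a b : WithOne S, (x : WithOne S) = a * (s : WithOne S) * b}

/-- Green's relation: `s` and `t` generate the same principal two-sided ideal. -/
def JEquiv (s t : S) : Prop := principalIdeal s = principalIdeal t

/-- `J` is a `𝒥`-class of `S`. -/
def IsJClass (J : Set S) : Prop := ∃ s : S, J = {t | JEquiv t s}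

/-- Von Neumann regularity of an element. -/
def IsRegularElem (s : S) : Prop := ∃ t : S, s = s * t * s

/-- A regular `𝒥`-class: one that contains a regular element. -/
def IsRegularJClass (J : Set S) : Prop := IsJClass J ∧ ∃ s ∈ J, IsRegularElem s

/-- The set of all elements of `S` that are not `𝒥`-above (some, equivalently all) elements
of `J`. -/
def notAbove (J : Set S) : Set S := {s | ¬ J ⊆ principalIdeal s}

/-- `z` is a (two-sided) zero element of `S`. -/
def IsZeroElem (z : S) : Prop := ∀ s : S, z * s = z ∧ s * z = z

/-- A (nonempty, two-sided) ideal of `S`. -/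
structure IsIdeal (I : Set S) : Prop where
  nonempty : I.Nonempty
  mul_mem_left : ∀ (s : S) {x : S}, x ∈ I → s * x ∈ I
  mul_mem_right : ∀ {x : S} (s : S), x ∈ I → x * s ∈ I

/-- An ideal, viewed as a semigroup in its own right. -/
def IsIdeal.toSubsemigroup {I : Set S} (h : IsIdeal I) : Subsemigroup S where
  carrier := I
  mul_mem' := fun {a _} _ hb => h.mul_mem_left a hb

/-- A minimal ideal of `S`. -/
def IsMinimalIdeal (I : Set S) : Prop :=
  IsIdeal I ∧ ∀ I' : Set S, IsIdeal I' → I' ⊆ I → I' = I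

/-- `S` has a zero `z`, and `I` is minimal among the ideals of `S` different from `{z}`. -/
def IsZeroMinimalIdeal (I : Set S) : Prop :=
  ∃ z : S, IsZeroElem z ∧ IsIdeal I ∧ I ≠ {z} ∧
    ∀ I' : Set S, IsIdeal I' → I' ≠ {z} → I' ⊆ I → I' = I

/-- `S` acts faithfully on the right of `I`. -/
def ActsFaithfullyOnRight (I : Set S) : Prop :=
  ∀ s t : S, (∀ x ∈ I, x * s = x * t) → s = t

/-- `S` acts faithfully on the left of `I`. -/
def ActsFaithfullyOnLeft (I : Set S) : Prop :=
  ∀ s t : S, (∀ x ∈ I, s * x = t * x) → s = t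

/-- A distinguished ideal: a minimal or `0`-minimal ideal on which `S` acts faithfully on both
sides. -/
structure IsDistinguishedIdeal (I : Set S) : Prop where
  minimal : IsMinimalIdeal I ∨ IsZeroMinimalIdeal I
  faithful_right : ActsFaithfullyOnRight I
  faithful_left : ActsFaithfullyOnLeft I

theorem IsDistinguishedIdeal.isIdeal {I : Set S} (h : IsDistinguishedIdeal I) : IsIdeal I := by
  rcases h.minimal with h | ⟨_, _, h, _⟩
  · exact h.1
  · exact h

variable (S) in
/-- `S` is generalized group mapping. -/
def IsGeneralizedGroupMapping : Prop := ∃ I : Set S, IsDistinguishedIdeal I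

/-- The maximal subgroup `G_e` at the idempotent `e`: the group of units of the monoid `eSe`. -/
def maximalSubgroup (e : S) : Set S :=
  {g | (∃ s, g = e * s * e) ∧ ∃ h : S, (∃ s, h = e * s * e) ∧ g * h = e ∧ h * g = e}

variable (S) in
/-- All maximal subgroups are trivial. -/
def IsAperiodic : Prop := ∀ e : S, IsIdempotentElem e → maximalSubgroup e = {e}

end Semigroups

section Modules

/-- A right module structure on the `k`-module `M` over a not necessarily unital `k`-algebra `A`:
a `k`-bilinear map `M × A → M` with `m(ab) = (ma)b`, encoded as a homomorphism of non-unital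
`k`-algebras from `A` to the opposite of `End_k M`. -/
abbrev RightModule (k A M : Type*) [CommSemiring k] [NonUnitalSemiring A] [Module k A]
    [AddCommMonoid M] [Module k M] : Type _ :=
  A →ₙₐ[k] (Module.End k M)ᵐᵒᵖ

variable {k A M : Type*} [CommSemiring k] [NonUnitalSemiring A] [Module k A]
  [AddCommMonoid M] [Module k M]

/-- The action `m ↦ m a`. -/
def RightModule.act (ρ : RightModule k A M) (m : M) (a : A) : M := (ρ a).unop m

/-- `M A ≠ 0`. -/
def RightModule.IsNonzeroAction (ρ : RightModule k A M) : Prop :=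
  ∃ (m : M) (a : A), ρ.act m a ≠ 0

/-- `M A ≠ 0`, and the only congruences on the `A`-module `M` are equality and the universal
relation; that is, `M` has only trivial quotient modules. -/
def RightModule.IsSimple (ρ : RightModule k A M) : Prop :=
  ρ.IsNonzeroAction ∧
    ∀ c : ModuleCon k M, (∀ (x y : M) (a : A), c.r x y → c.r (ρ.act x a) (ρ.act y a)) →
      (∀ x y : M, c.r x y → x = y) ∨ (∀ x y : M, c.r x y)

/-- `M A ≠ 0`, and `M` has no proper non-zero `A`-submodules. -/
def RightModule.IsMinimal (ρ : RightModule k A M) : Prop :=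
  ρ.IsNonzeroAction ∧
    ∀ N : Submodule k M, (∀ x ∈ N, ∀ a : A, ρ.act x a ∈ N) → N = ⊥ ∨ N = ⊤

/-- Both simple and minimal. -/
def RightModule.IsIrreducible (ρ : RightModule k A M) : Prop :=
  ρ.IsSimple ∧ ρ.IsMinimal

end Modules

section SemigroupModules

variable {k S M : Type*} [CommSemiring k] [Semigroup S] [AddCommMonoid M] [Module k M]

/-- The action of a semigroup element on a `kS`-module. -/
noncomputable def actElem (ρ : RightModule k (MonoidAlgebra k S) M) (m : M) (s : S) : M :=
  ρ.act m (MonoidAlgebra.single s 1)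

/-- Faithfulness for `S`: elements of `S` acting equally on `M` are equal. -/
def IsFaithfulModule (ρ : RightModule k (MonoidAlgebra k S) M) : Prop :=
  ∀ s t : S, (∀ m : M, actElem ρ m s = actElem ρ m t) → s = t

/-- `Ann M = {s ∈ S | M s = 0}`. -/
def annihilator (ρ : RightModule k (MonoidAlgebra k S) M) : Set S :=
  {s | ∀ m : M, actElem ρ m s = 0}

/-- `J` is an apex of `M`: a regular `𝒥`-class such that `Ann M` is the set of elements not
`𝒥`-above `J`. -/
def IsApex (ρ : RightModule k (MonoidAlgebra k S) M) (J : Set S) : Prop :=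
  IsRegularJClass J ∧ annihilator ρ = notAbove J

end SemigroupModules

end SemigroupRep

namespace SemigroupRep

/-! ### Principal ideals, idempotents and the local monoids `eSe` -/

section Semigroups

variable {S : Type*} [Semigroup S]

/-! Choose `s` outside `Ann M` with `J(s)` minimal; its class is the apex. Then every ideal not
annihilating `M` contains `J(s)`, and faithfulness leaves at most a zero element in `Ann M`, so
`J(s)` is minimal or `0`-minimal. For an ideal `I` not annihilating `M`, simplicity says that `I`
separates points of `M`, giving left faithfulness, and minimality says that `mI` spans `M` for `m ≠
0`, giving right faithfulness. If addition is idempotent, let `G` be the unit group of `eSe` with `e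
∈ J(s)`, and let `w` be the sum of the orbit `mG`. It is fixed by `G`, and if `w ≠ 0` then `wJ(s)`
spans `M`. For `x ∈ J(s)`, `exe` lies in `G` or kills `M`, so `wxe` is `w` or `0`. Hence `G` fixes
`Me`, and faithfulness makes `G` trivial. -/

theorem mem_principalIdeal_self (s : S) : s ∈ principalIdeal s :=
  ⟨1, 1, by simp⟩

theorem isIdeal_principalIdeal (s : S) : IsIdeal (principalIdeal s) where
  nonempty := ⟨s, mem_principalIdeal_self s⟩
  mul_mem_left := by
    rintro t x ⟨a, b, h⟩
    exact ⟨t * a, b, by rw [WithOne.coe_mul, h]; simp only [mul_assoc]⟩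
  mul_mem_right := by
    rintro x t ⟨a, b, h⟩
    exact ⟨a, b * t, by rw [WithOne.coe_mul, h]; simp only [mul_assoc]⟩

theorem IsIdeal.principalIdeal_subset {I : Set S} (hI : IsIdeal I) {s : S} (hs : s ∈ I) :
    principalIdeal s ⊆ I := by
  rintro x ⟨a, b, h⟩
  cases a using WithOne.recOneCoe with
  | one =>
    cases b using WithOne.recOneCoe with
    | one =>
      rw [one_mul, mul_one, WithOne.coe_inj] at h
      exact h ▸ hs
    | coe b =>
      rw [one_mul, ← WithOne.coe_mul, WithOne.coe_inj] at h
      exact h ▸ hI.mul_mem_right b hs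
  | coe a =>
    cases b using WithOne.recOneCoe with
    | one =>
      rw [mul_one, ← WithOne.coe_mul, WithOne.coe_inj] at h
      exact h ▸ hI.mul_mem_left a hs
    | coe b =>
      rw [← WithOne.coe_mul, ← WithOne.coe_mul, WithOne.coe_inj] at h
      exact h ▸ hI.mul_mem_right b (hI.mul_mem_left a hs)

theorem principalIdeal_subset_iff {s t : S} :
    principalIdeal s ⊆ principalIdeal t ↔ s ∈ principalIdeal t :=
  ⟨fun h ↦ h (mem_principalIdeal_self s), (isIdeal_principalIdeal t).principalIdeal_subset⟩

theorem jEquiv_iff {s t : S} : JEquiv s t ↔ s ∈ principalIdeal t ∧ t ∈ principalIdeal s := by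
  rw [JEquiv, Set.Subset.antisymm_iff, principalIdeal_subset_iff, principalIdeal_subset_iff]

theorem IsIdeal.inter {I K : Set S} (hI : IsIdeal I) (hK : IsIdeal K) : IsIdeal (I ∩ K) where
  nonempty := by
    obtain ⟨x, hx⟩ := hI.nonempty
    obtain ⟨y, hy⟩ := hK.nonempty
    exact ⟨x * y, hI.mul_mem_right y hx, hK.mul_mem_left x hy⟩
  mul_mem_left s _ hx := ⟨hI.mul_mem_left s hx.1, hK.mul_mem_left s hx.2⟩
  mul_mem_right s hx := ⟨hI.mul_mem_right s hx.1, hK.mul_mem_right s hx.2⟩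

theorem IsIdeal.zero_mem {I : Set S} (hI : IsIdeal I) {z : S} (hz : IsZeroElem z) : z ∈ I := by
  obtain ⟨x, hx⟩ := hI.nonempty
  exact (hz x).1 ▸ hI.mul_mem_left z hx

theorem IsIdeal.coe_mul_mem {I : Set S} (hI : IsIdeal I) {y : S} (hy : y ∈ I) (b : WithOne S) :
    ∃ w ∈ I, (w : WithOne S) = y * b := by
  cases b using WithOne.recOneCoe with
  | one => exact ⟨y, hy, (mul_one _).symm⟩
  | coe b => exact ⟨y * b, hI.mul_mem_right b hy, WithOne.coe_mul _ _⟩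

/-- In a finite semigroup, if `x` is `𝒥`-below `x * y`, then `x` has a right identity in every
ideal containing `y`. -/
theorem IsIdeal.exists_idempotent_mul_eq [Finite S] {I : Set S} (hI : IsIdeal I) {x y : S}
    (hy : y ∈ I) (hxy : x ∈ principalIdeal (x * y)) :
    ∃ e ∈ I, IsIdempotentElem e ∧ x * e = x := by
  obtain ⟨a, b, h⟩ := hxy
  obtain ⟨w, hwI, hw⟩ := hI.coe_mul_mem hy b
  -- `T` is a nonempty finite subsemigroup, so it contains an idempotent `e`; then `x = axe` gives
  -- `xe = x`.
  let T : Set S := {w | w ∈ I ∧ ∃ a : WithOne S, (x : WithOne S) = a * x * w}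
  let : TopologicalSpace S := ⊥
  have : DiscreteTopology S := ⟨rfl⟩
  have hT : T.Nonempty := ⟨w, hwI, a, by rw [hw]; simpa [mul_assoc] using h⟩
  obtain ⟨e, ⟨heI, a, ha⟩, he⟩ := exists_idempotent_in_compact_subsemigroup
    (fun _ ↦ continuous_of_discreteTopology) T hT (Set.toFinite T).isCompact (by
      rintro p ⟨hp, a, ha⟩ q ⟨-, c, hc⟩
      refine ⟨hI.mul_mem_right q hp, c * a, ?_⟩
      rw [hc]
      nth_rw 1 [ha]
      nth_rw 1 [hc]
      simp [mul_assoc])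
  refine ⟨e, heI, he, WithOne.coe_inj.1 ?_⟩
  rw [WithOne.coe_mul]
  conv_lhs => rw [ha]
  rw [mul_assoc, ← WithOne.coe_mul, he, ← ha]

/-- The local monoid `eSe`. -/
instance cornerMonoid {e : S} (he : IsIdempotentElem e) : Monoid he.Corner where
  __ : Semigroup he.Corner := inferInstanceAs <| Semigroup (Subsemigroup.corner e)
  one := ⟨e, e, by simp_rw [he.eq]⟩
  one_mul r := Subtype.ext ((Subsemigroup.mem_corner_iff he).mp r.2).1
  mul_one r := Subtype.ext ((Subsemigroup.mem_corner_iff he).mp r.2).2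

instance finite_corner [Finite S] {e : S} (he : IsIdempotentElem e) : Finite he.Corner :=
  inferInstanceAs <| Finite (Subsemigroup.corner e)

theorem exists_corner_coe_eq {e : S} (he : IsIdempotentElem e) (a : WithOne S) :
    ∃ p : he.Corner, (p.1 : WithOne S) = e * a * e := by
  cases a using WithOne.recOneCoe with
  | one => exact ⟨1, by rw [mul_one, ← WithOne.coe_mul, he.eq]; rfl⟩
  | coe a => exact ⟨⟨e * a * e, a, rfl⟩, by simp⟩

/-- Multiplying `e = aqb` by `e` on both sides gives `pqr = 1` in the finite monoid `eSe`, where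
one-sided inverses are two-sided. -/
theorem exists_unit_of_mem_principalIdeal [Finite S] {e : S} (he : IsIdempotentElem e)
    (q : he.Corner) (hq : e ∈ principalIdeal q.1) : IsUnit q := by
  obtain ⟨a, b, h⟩ := hq
  obtain ⟨p, hp⟩ := exists_corner_coe_eq he a
  obtain ⟨r, hr⟩ := exists_corner_coe_eq he b
  obtain ⟨h1, h2⟩ := (Subsemigroup.mem_corner_iff he).mp q.2
  have key : p * (q * r) = 1 := by
    refine Subtype.ext (WithOne.coe_inj.1 ?_)
    change ((p.1 * (q.1 * r.1) : S) : WithOne S) = (e : WithOne S)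
    have h1' : (e : WithOne S) * q.1 = q.1 := by rw [← WithOne.coe_mul, h1]
    have h2' : (q.1 : WithOne S) * e = q.1 := by rw [← WithOne.coe_mul, h2]
    have he' : (e : WithOne S) * e = e := by rw [← WithOne.coe_mul, he.eq]
    calc ((p.1 * (q.1 * r.1) : S) : WithOne S)
        = e * a * (e * q.1) * e * b * e := by
          rw [WithOne.coe_mul, WithOne.coe_mul, hp, hr]; simp only [mul_assoc]
      _ = e * (a * q.1 * b) * e := by
          rw [h1', mul_assoc (e * a : WithOne S), h2']; simp only [mul_assoc]
      _ = e := by rw [← h, he', he']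
  have hp' : IsUnit p := IsUnit.of_mul_eq_one _ key
  have hqr : IsUnit (q * r) := IsUnit.of_mul_eq_one_right _ key
  exact isUnit_of_mul_isUnit_left hqr

end Semigroups

/-! ### Action of ideals on minimal and simple modules -/

section SemigroupModules

variable {k S M : Type*} [CommSemiring k] [Semigroup S] [AddCommMonoid M] [Module k M]
  (ρ : RightModule k (MonoidAlgebra k S) M)

theorem act_add_right (m : M) (a b : MonoidAlgebra k S) :
    ρ.act m (a + b) = ρ.act m a + ρ.act m b := by
  simp [RightModule.act]

theorem act_zero_right (m : M) : ρ.act m 0 = 0 := by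
  simp [RightModule.act]

theorem act_single (m : M) (s : S) (r : k) :
    ρ.act m (MonoidAlgebra.single s r) = r • actElem ρ m s := by
  have : MonoidAlgebra.single s r = r • MonoidAlgebra.single s (1 : k) := by simp
  rw [this, RightModule.act, map_smul]
  rfl

theorem actElem_mul (m : M) (s t : S) : actElem ρ m (s * t) = actElem ρ (actElem ρ m s) t := by
  have : MonoidAlgebra.single (s * t) (1 : k) =
      MonoidAlgebra.single s 1 * MonoidAlgebra.single t 1 := by simp
  rw [actElem, this, RightModule.act, map_mul]
  rfl

/-- The action of a semigroup element, as a linear map. -/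
noncomputable def actHom (s : S) : M →ₗ[k] M := (ρ (MonoidAlgebra.single s 1)).unop

theorem actHom_apply (s : S) (m : M) : actHom ρ s m = actElem ρ m s := rfl

theorem actElem_add (m n : M) (s : S) : actElem ρ (m + n) s = actElem ρ m s + actElem ρ n s :=
  map_add (actHom ρ s) m n

theorem actElem_smul (r : k) (m : M) (s : S) : actElem ρ (r • m) s = r • actElem ρ m s :=
  map_smul (actHom ρ s) r m

theorem actElem_zero (s : S) : actElem ρ 0 s = 0 :=
  map_zero (actHom ρ s)

theorem act_mem_of_actElem_mem (N : Submodule k M) {x : M} (h : ∀ s, actElem ρ x s ∈ N)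
    (a : MonoidAlgebra k S) : ρ.act x a ∈ N := by
  induction a using MonoidAlgebra.induction_linear with
  | zero => rw [act_zero_right]; exact N.zero_mem
  | add a b ha hb => rw [act_add_right]; exact N.add_mem ha hb
  | single s r => rw [act_single]; exact N.smul_mem r (h s)

theorem isIdeal_annihilator (h : (annihilator ρ).Nonempty) : IsIdeal (annihilator ρ) where
  nonempty := h
  mul_mem_left s x hx m := by rw [actElem_mul]; exact hx _
  mul_mem_right s hx m := by rw [actElem_mul, hx, actElem_zero]

theorem principalIdeal_subset_annihilator {s : S} (hs : s ∈ annihilator ρ) :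
    principalIdeal s ⊆ annihilator ρ :=
  (isIdeal_annihilator ρ ⟨s, hs⟩).principalIdeal_subset hs

variable {ρ}

theorem exists_notMem_annihilator (hnz : ρ.IsNonzeroAction) : ∃ s, s ∉ annihilator ρ := by
  by_contra! h
  obtain ⟨m, a, hma⟩ := hnz
  exact hma ((Submodule.mem_bot k).1
    (act_mem_of_actElem_mem ρ ⊥ (fun s ↦ (Submodule.mem_bot k).2 (h s m)) a))

/-- A version of minimality that only mentions the action of the semigroup. -/
theorem RightModule.IsMinimal.eq_bot_or_eq_top (h : ρ.IsMinimal) (N : Submodule k M)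
    (hN : ∀ x ∈ N, ∀ s, actElem ρ x s ∈ N) : N = ⊥ ∨ N = ⊤ :=
  h.2 N fun x hx ↦ act_mem_of_actElem_mem ρ N (hN x hx)

variable {I : Set S}

/-- The elements killed by `I` form a submodule, proper because `I` does not annihilate `M`. -/
theorem RightModule.IsMinimal.eq_zero_of_forall (h : ρ.IsMinimal) (hI : IsIdeal I)
    (hIA : ¬ I ⊆ annihilator ρ) {m : M} (hm : ∀ x ∈ I, actElem ρ m x = 0) : m = 0 := by
  let N : Submodule k M := ⨅ x ∈ I, LinearMap.ker (actHom ρ x)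
  have mem_N (n : M) : n ∈ N ↔ ∀ x ∈ I, actElem ρ n x = 0 := by
    simp [N, Submodule.mem_iInf, actHom_apply]
  rcases h.eq_bot_or_eq_top N (by
    intro n hn s
    rw [mem_N] at hn ⊢
    intro x hx
    rw [← actElem_mul]
    exact hn _ (hI.mul_mem_left s hx)) with hN | hN
  · exact (Submodule.mem_bot k).1 (hN ▸ (mem_N m).2 hm)
  · exact absurd (fun x hx n ↦ (mem_N n).1 (hN ▸ Submodule.mem_top) x hx) hIA

theorem RightModule.IsMinimal.span_eq_top (h : ρ.IsMinimal) (hI : IsIdeal I)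
    (hIA : ¬ I ⊆ annihilator ρ) {m : M} (hm : m ≠ 0) :
    Submodule.span k (actElem ρ m '' I) = ⊤ := by
  rcases h.eq_bot_or_eq_top (Submodule.span k (actElem ρ m '' I)) (by
    intro n hn s
    rw [← actHom_apply, ← Submodule.mem_comap]
    refine Submodule.span_le.2 ?_ hn
    rintro _ ⟨x, hx, rfl⟩
    exact Submodule.subset_span ⟨x * s, hI.mul_mem_right s hx, actElem_mul ρ m x s⟩) with hN | hN
  · refine absurd (h.eq_zero_of_forall hI hIA fun x hx ↦ ?_) hm
    exact (Submodule.mem_bot k).1 (hN ▸ Submodule.subset_span ⟨x, hx, rfl⟩)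
  · exact hN

/-- Agreement on `I` is a module congruence; were it universal, comparison with `0` would show that
`I` annihilates `M`. -/
theorem RightModule.IsSimple.eq_of_forall (h : ρ.IsSimple) (hI : IsIdeal I)
    (hIA : ¬ I ⊆ annihilator ρ) {m n : M} (hmn : ∀ x ∈ I, actElem ρ m x = actElem ρ n x) :
    m = n := by
  let c : ModuleCon k M :=
    { r := fun m n ↦ ∀ x ∈ I, actElem ρ m x = actElem ρ n x
      iseqv := ⟨fun _ _ _ ↦ rfl, fun h x hx ↦ (h x hx).symm,
        fun h h' x hx ↦ (h x hx).trans (h' x hx)⟩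
      add' := fun h h' x hx ↦ by rw [actElem_add, actElem_add, h x hx, h' x hx]
      smul := fun r _ _ h x hx ↦ by rw [actElem_smul, actElem_smul, h x hx] }
  rcases h.2 c (by
    intro p q a hpq
    induction a using MonoidAlgebra.induction_linear with
    | zero => rw [act_zero_right, act_zero_right]
    | add a b ha hb =>
      intro x hx
      rw [act_add_right, act_add_right, actElem_add, actElem_add, ha x hx, hb x hx]
    | single s r =>
      intro x hx
      rw [act_single, act_single, actElem_smul, actElem_smul, ← actElem_mul, ← actElem_mul,
        hpq _ (hI.mul_mem_left s hx)]) with hc | hc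
  · exact hc m n hmn
  · exact absurd (fun x hx p ↦ (hc p 0 x hx).trans (actElem_zero ρ x)) hIA

/-- If multiplication by `s` and `t` on the left of an ideal not annihilating `M` agree, then
`s` and `t` act equally on `M`. -/
theorem RightModule.IsSimple.actElem_eq_of_forall (h : ρ.IsSimple) (hI : IsIdeal I)
    (hIA : ¬ I ⊆ annihilator ρ) {s t : S} (hst : ∀ x ∈ I, s * x = t * x) (m : M) :
    actElem ρ m s = actElem ρ m t :=
  h.eq_of_forall hI hIA fun x hx ↦ by rw [← actElem_mul, ← actElem_mul, hst x hx]

/-- If multiplication by `s` and `t` on the right of an ideal not annihilating `M` agree, then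
`s` and `t` act equally on `M`. -/
theorem RightModule.IsMinimal.actElem_eq_of_forall (h : ρ.IsMinimal) (hI : IsIdeal I)
    (hIA : ¬ I ⊆ annihilator ρ) {s t : S} (hst : ∀ x ∈ I, x * s = x * t) (m : M) :
    actElem ρ m s = actElem ρ m t := by
  rcases eq_or_ne m 0 with rfl | hm
  · rw [actElem_zero, actElem_zero]
  · rw [← actHom_apply, ← actHom_apply]
    refine LinearMap.congr_fun (LinearMap.ext_on (h.span_eq_top hI hIA hm) ?_) m
    rintro _ ⟨x, hx, rfl⟩
    rw [actHom_apply, actHom_apply, ← actElem_mul, ← actElem_mul, hst x hx]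

theorem RightModule.IsMinimal.exists_actElem_mul_ne_zero (h : ρ.IsMinimal) (hI : IsIdeal I)
    (hIA : ¬ I ⊆ annihilator ρ) {t : S} (ht : t ∉ annihilator ρ) :
    ∃ x ∈ I, t * x ∉ annihilator ρ := by
  by_contra! hx
  refine ht fun m ↦ h.eq_zero_of_forall hI hIA fun x hxI ↦ ?_
  rw [← actElem_mul]
  exact hx x hxI m

/-! ### Existence and uniqueness of the apex -/

theorem exists_isApex [Finite S] (h : ρ.IsMinimal) : ∃ J, IsApex ρ J := by
  obtain ⟨s, hs, hmin⟩ : ∃ s ∉ annihilator ρ, ∀ t ∉ annihilator ρ,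
      t ∈ principalIdeal s → s ∈ principalIdeal t := by
    obtain ⟨s, hs, hmin⟩ := (Set.toFinite (annihilator ρ)ᶜ).exists_minimalFor
      principalIdeal _ (exists_notMem_annihilator h.1)
    exact ⟨s, hs, fun t ht hts ↦ principalIdeal_subset_iff.1
      (hmin ht (principalIdeal_subset_iff.2 hts))⟩
  have hI := isIdeal_principalIdeal s
  have hIA : ¬ principalIdeal s ⊆ annihilator ρ := fun h ↦ hs (h (mem_principalIdeal_self s))
  refine ⟨{t | JEquiv t s}, ⟨⟨s, rfl⟩, ?_⟩, ?_⟩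
  -- Minimality puts `s` in `J(sy)`, so `s = se` for an idempotent `e ∈ J(s)`, which is then
  -- `𝒥`-equivalent to `s`.
  · obtain ⟨y, hy, hsy⟩ := h.exists_actElem_mul_ne_zero hI hIA hs
    obtain ⟨e, heI, he, hse⟩ := hI.exists_idempotent_mul_eq hy
      (hmin _ hsy (hI.mul_mem_left s hy))
    refine ⟨e, jEquiv_iff.2 ⟨heI, hse ▸ (isIdeal_principalIdeal e).mul_mem_left s
      (mem_principalIdeal_self e)⟩, e, by rw [he.eq, he.eq]⟩
  · ext t
    constructor
    · intro ht hJ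
      exact hs (principalIdeal_subset_annihilator ρ ht (hJ (show JEquiv s s from rfl)))
    · intro hJ
      by_contra ht
      obtain ⟨x, hx, htx⟩ := h.exists_actElem_mul_ne_zero hI hIA ht
      refine hJ fun y hy ↦ ?_
      refine (isIdeal_principalIdeal t).principalIdeal_subset
        ((isIdeal_principalIdeal t).mul_mem_right x (mem_principalIdeal_self t)) ?_
      exact principalIdeal_subset_iff.2 (hmin _ htx (hI.mul_mem_left t hx))
        (jEquiv_iff.1 hy).1

theorem notAbove_eq_of_jClass (s : S) :
    notAbove {t | JEquiv t s} = {t | s ∉ principalIdeal t} := by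
  ext t
  refine not_congr ⟨fun h ↦ h (show JEquiv s s from rfl), fun h x hx ↦ ?_⟩
  exact principalIdeal_subset_iff.2 h (jEquiv_iff.1 hx).1

theorem IsApex.unique {J K : Set S} (hJ : IsApex ρ J) (hK : IsApex ρ K) : J = K := by
  obtain ⟨⟨⟨s, rfl⟩, -⟩, hs⟩ := hJ
  obtain ⟨⟨⟨t, rfl⟩, -⟩, ht⟩ := hK
  rw [notAbove_eq_of_jClass] at hs ht
  have key (x : S) : s ∈ principalIdeal x ↔ t ∈ principalIdeal x :=
    not_iff_not.1 (Set.ext_iff.1 (hs.symm.trans ht) x)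
  have hst : JEquiv s t :=
    jEquiv_iff.2 ⟨(key t).2 (mem_principalIdeal_self t), (key s).1 (mem_principalIdeal_self s)⟩
  ext x
  exact ⟨fun h ↦ h.trans hst, fun h ↦ h.trans hst.symm⟩

/-! ### The distinguished ideal and its maximal subgroups -/

theorem IsFaithfulModule.subsingleton_annihilator (h : IsFaithfulModule ρ) :
    (annihilator ρ).Subsingleton :=
  fun s hs t ht ↦ h s t fun m ↦ (hs m).trans (ht m).symm

theorem IsFaithfulModule.isZeroElem (h : IsFaithfulModule ρ) {z : S} (hz : z ∈ annihilator ρ) :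
    IsZeroElem z := fun s ↦
  have hA := isIdeal_annihilator ρ ⟨z, hz⟩
  ⟨h.subsingleton_annihilator (hA.mul_mem_right s hz) hz,
    h.subsingleton_annihilator (hA.mul_mem_left s hz) hz⟩

variable {s : S}

theorem not_principalIdeal_subset_annihilator (hs : annihilator ρ = {t | s ∉ principalIdeal t}) :
    ¬ principalIdeal s ⊆ annihilator ρ := fun h ↦
  (hs ▸ h (mem_principalIdeal_self s) : s ∈ {t | s ∉ principalIdeal t}) (mem_principalIdeal_self s)

theorem IsIdeal.principalIdeal_subset_of_not_subset
    (hs : annihilator ρ = {t | s ∉ principalIdeal t}) (hI : IsIdeal I)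
    (hIA : ¬ I ⊆ annihilator ρ) : principalIdeal s ⊆ I := by
  obtain ⟨x, hx, hxA⟩ := Set.not_subset.1 hIA
  rw [hs, Set.mem_ofPred_eq, not_not] at hxA
  exact hI.principalIdeal_subset (hI.principalIdeal_subset hx hxA)

theorem isDistinguishedIdeal_principalIdeal (hirr : ρ.IsIrreducible)
    (hf : IsFaithfulModule ρ) (hs : annihilator ρ = {t | s ∉ principalIdeal t}) :
    IsDistinguishedIdeal (principalIdeal s) := by
  have hI := isIdeal_principalIdeal s
  have hIA := not_principalIdeal_subset_annihilator hs
  refine ⟨?_, fun p q hpq ↦ hf p q (hirr.2.actElem_eq_of_forall hI hIA hpq),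
    fun p q hpq ↦ hf p q (hirr.1.actElem_eq_of_forall hI hIA hpq)⟩
  rcases (annihilator ρ).eq_empty_or_nonempty with hA | ⟨z, hz⟩
  · refine Or.inl ⟨hI, fun K hK hKI ↦ hKI.antisymm
      (hK.principalIdeal_subset_of_not_subset hs ?_)⟩
    rw [hA]
    exact fun h ↦ hK.nonempty.ne_empty (Set.subset_empty_iff.1 h)
  · refine Or.inr ⟨z, hf.isZeroElem hz, hI, ?_, fun K hK hKz hKI ↦ hKI.antisymm
      (hK.principalIdeal_subset_of_not_subset hs fun hKA ↦ hKz ?_)⟩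
    · rintro h
      exact hIA (h ▸ Set.singleton_subset_iff.2 hz)
    · exact hK.nonempty.subset_singleton_iff.1
        fun x hx ↦ hf.subsingleton_annihilator (hKA hx) hz

theorem IsDistinguishedIdeal.eq_principalIdeal (hirr : ρ.IsIrreducible)
    (hf : IsFaithfulModule ρ) (hs : annihilator ρ = {t | s ∉ principalIdeal t})
    (hI : IsDistinguishedIdeal I) : I = principalIdeal s := by
  have hsA := not_principalIdeal_subset_annihilator hs
  have hK := hI.isIdeal.inter (isIdeal_principalIdeal s)
  have hsI : principalIdeal s ⊆ I := by
    -- Otherwise `I ∩ J(s)` is just a zero `z`, so `xs = z = xz` on `I`, and faithfulness forces `s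
    -- = z`.
    refine (hK.principalIdeal_subset_of_not_subset hs fun hKA ↦ ?_).trans Set.inter_subset_left
    obtain ⟨z, hz⟩ := hK.nonempty
    have hz0 := hf.isZeroElem (hKA hz)
    have hsz : s = z := hI.faithful_right s z fun x hx ↦ by
      rw [(hz0 x).2]
      exact hf.subsingleton_annihilator (hKA ⟨hI.isIdeal.mul_mem_right s hx,
        (isIdeal_principalIdeal s).mul_mem_left x (mem_principalIdeal_self s)⟩) (hKA hz)
    exact hsA (principalIdeal_subset_annihilator ρ (hsz ▸ hKA hz))
  rcases hI.minimal with h | ⟨z, hz, hI', hIz, h⟩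
  · exact (h.2 _ (isIdeal_principalIdeal s) hsI).symm
  -- If `J(s) = {z}`, faithfulness on it collapses `S` to `{z}`, contradicting `I ≠ {z}`.
  · refine (h _ (isIdeal_principalIdeal s) (fun hsz ↦ hIz ?_) hsI).symm
    refine hI'.nonempty.subset_singleton_iff.1 fun x _ ↦
      (isDistinguishedIdeal_principalIdeal hirr hf hs).faithful_right x z ?_
    rw [hsz]
    rintro _ rfl
    rw [(hz x).1, (hz _).1]

theorem principalIdeal_eq_jClass_or (hf : IsFaithfulModule ρ)
    (hs : annihilator ρ = {t | s ∉ principalIdeal t}) :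
    principalIdeal s = {t | JEquiv t s} ∨
      ∃ z, IsZeroElem z ∧ principalIdeal s = {t | JEquiv t s} ∪ {z} := by
  have hJ {t : S} (ht : t ∈ principalIdeal s) (htA : t ∉ annihilator ρ) : JEquiv t s := by
    rw [hs, Set.mem_ofPred_eq, not_not] at htA
    exact jEquiv_iff.2 ⟨ht, htA⟩
  rcases (annihilator ρ).eq_empty_or_nonempty with hA | ⟨z, hz⟩
  · exact Or.inl (Set.Subset.antisymm (fun t ht ↦ hJ ht (hA ▸ Set.notMem_empty t))
      fun t ht ↦ (jEquiv_iff.1 ht).1)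
  · refine Or.inr ⟨z, hf.isZeroElem hz, Set.Subset.antisymm (fun t ht ↦ ?_) ?_⟩
    · by_cases htA : t ∈ annihilator ρ
      · exact Or.inr (hf.subsingleton_annihilator htA hz)
      · exact Or.inl (hJ ht htA)
    · rintro t (ht | rfl)
      · exact (jEquiv_iff.1 ht).1
      · exact (isIdeal_principalIdeal s).zero_mem (hf.isZeroElem hz)

/-- Over a module with idempotent addition, the units of `eSe` act trivially on `Me`, for every
idempotent `e` in the ideal generated by the apex. -/
theorem actElem_unit_eq [Finite S] (h : ρ.IsMinimal) (hidem : ∀ m : M, m + m = m)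
    (hs : annihilator ρ = {t | s ∉ principalIdeal t}) {e : S} (he : IsIdempotentElem e)
    (hes : e ∈ principalIdeal s) (u : he.Cornerˣ) (m : M) :
    actElem ρ m u.1.1 = actElem ρ m e := by
  classical
  have := Fintype.ofFinite he.Cornerˣ
  have hsA := not_principalIdeal_subset_annihilator hs
  have corner_mul (p : he.Corner) : e * p.1 = p.1 := ((Subsemigroup.mem_corner_iff he).mp p.2).1
  let w : M := ∑ v : he.Cornerˣ, actElem ρ m v.1.1
  have hwv (v : he.Cornerˣ) : actElem ρ w v.1.1 = w := by
    rw [← actHom_apply, map_sum]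
    exact Fintype.sum_equiv (Equiv.mulRight v) _ _ fun v' ↦ (actElem_mul ρ m v'.1.1 v.1.1).symm
  have hwe : actElem ρ w e = w := hwv 1
  -- By idempotency `w` absorbs each of its summands, so `w = 0` forces them all to vanish.
  have hle (v : he.Cornerˣ) : actElem ρ m v.1.1 + w = w := by
    have hw : actElem ρ m v.1.1 + _ = w :=
      Finset.add_sum_erase Finset.univ (fun v : he.Cornerˣ ↦ actElem ρ m v.1.1)
        (Finset.mem_univ v)
    rw [← hw, ← add_assoc, hidem]
  by_cases hw : w = 0
  · have h0 (v : he.Cornerˣ) : actElem ρ m v.1.1 = 0 := by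
      simpa [hw] using hle v
    rw [h0 u]
    exact (h0 1).symm
  · have key : ∀ n : M, actElem ρ (actElem ρ n e) u.1.1 = actElem ρ n e := by
      intro n
      have hn : n ∈ Submodule.span k (actElem ρ w '' principalIdeal s) :=
        h.span_eq_top (isIdeal_principalIdeal s) hsA hw ▸ Submodule.mem_top
      simp only [← actHom_apply]
      rw [← LinearMap.comp_apply]
      refine LinearMap.eqOn_span (f := actHom ρ u.1.1 ∘ₗ actHom ρ e) (g := actHom ρ e) ?_ hn
      rintro _ ⟨x, hx, rfl⟩
      simp only [LinearMap.comp_apply, actHom_apply]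
      -- Since `we = w`, `wxe = wq`; outside `Ann M`, `q` is `𝒥`-above `e`, hence a unit fixing `w`.
      let q : he.Corner := ⟨e * x * e, x, rfl⟩
      have hq : actElem ρ (actElem ρ w x) e = actElem ρ w q.1 := by
        rw [actElem_mul, actElem_mul, hwe]
      rw [hq]
      by_cases hqA : q.1 ∈ annihilator ρ
      · rw [hqA w, actElem_zero]
      · rw [hs, Set.mem_ofPred_eq, not_not] at hqA
        obtain ⟨v, hv⟩ := exists_unit_of_mem_principalIdeal he q
          (principalIdeal_subset_iff.2 hqA hes)
        rw [← hv, hwv, hwv]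
    rw [← key m, ← actElem_mul, corner_mul]

theorem isAperiodic_toSubsemigroup [Finite S] (h : ρ.IsMinimal) (hf : IsFaithfulModule ρ)
    (hidem : ∀ m : M, m + m = m) (hs : annihilator ρ = {t | s ∉ principalIdeal t})
    (hI : IsIdeal I) (hIs : I ⊆ principalIdeal s) : IsAperiodic hI.toSubsemigroup := by
  intro e he
  have he' : IsIdempotentElem e.1 := congrArg Subtype.val he
  refine Set.Subset.antisymm ?_ ?_
  · rintro g ⟨⟨p, hp⟩, g', ⟨q, hq⟩, hgg', hg'g⟩
    refine Subtype.ext ?_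
    have hp' : g.1 = e.1 * p.1 * e.1 := congrArg Subtype.val hp
    have h1 : g.1 * g'.1 = e.1 := congrArg Subtype.val hgg'
    have h2 : g'.1 * g.1 = e.1 := congrArg Subtype.val hg'g
    let u : he'.Cornerˣ :=
      { val := ⟨g.1, p.1, hp'.symm⟩
        inv := ⟨g'.1, q.1, (congrArg Subtype.val hq).symm⟩
        val_inv := Subtype.ext h1
        inv_val := Subtype.ext h2 }
    exact hf _ _ (actElem_unit_eq h hidem hs he' (hIs e.2) u)
  · rw [Set.singleton_subset_iff]
    have hee : e = e * e * e := by rw [he.eq, he.eq]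
    exact ⟨⟨e, hee⟩, e, ⟨e, hee⟩, he, he⟩

end SemigroupModules

end SemigroupRep

theorem mainTheorem10 {k S M : Type*} [CommSemiring k] [Semigroup S] [Finite S]
    [AddCommMonoid M] [Module k M]
    (ρ : SemigroupRep.RightModule k (MonoidAlgebra k S) M)
    (hirr : ρ.IsIrreducible) (hfaithful : SemigroupRep.IsFaithfulModule ρ) :
    (∃! J : Set S, SemigroupRep.IsApex ρ J) ∧
    ∀ J : Set S, SemigroupRep.IsApex ρ J →
      SemigroupRep.IsGeneralizedGroupMapping S ∧
      ∀ (I : Set S) (hI : SemigroupRep.IsDistinguishedIdeal I),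
        (I = J ∨ ∃ z : S, SemigroupRep.IsZeroElem z ∧ I = J ∪ {z}) ∧
        ((∀ m : M, m + m = m) → SemigroupRep.IsAperiodic hI.isIdeal.toSubsemigroup) := by
  obtain ⟨K, hK⟩ := SemigroupRep.exists_isApex hirr.2
  refine ⟨⟨K, hK, fun J hJ ↦ hJ.unique hK⟩, fun J hJ ↦ ?_⟩
  obtain ⟨⟨⟨s, rfl⟩, -⟩, hs⟩ := hJ
  rw [SemigroupRep.notAbove_eq_of_jClass] at hs
  refine ⟨⟨_, SemigroupRep.isDistinguishedIdeal_principalIdeal hirr hfaithful hs⟩,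
    fun I hI ↦ ?_⟩
  have hIs := hI.eq_principalIdeal hirr hfaithful hs
  refine ⟨?_, fun hidem ↦ SemigroupRep.isAperiodic_toSubsemigroup hirr.2 hfaithful hidem hs
    hI.isIdeal hIs.subset⟩
  rw [hIs]
  exact SemigroupRep.principalIdeal_eq_jClass_or hfaithful hs
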